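/- Let $b\neq 0$ be real. For $p\in\mathbb N$ set $h=1/(p+1)$, $B=(bh)^3$ and $z=2/B=2/(bh)^3$, and let $$R^{\nu,p}(z)=\sum_{0\le s\le p/2}\frac{(-1)^s(p-s)!}{s!}\binom{\nu+p-s}{p-2s}\Big(\frac 2z\Big)^{p-2s}$$ be the Lommel polynomial. Let $\mathrm{Ai},\mathrm{Bi}$ be the Airy functions and put $$D(b)=\frac{\pi}{b}\big(\mathrm{Ai}(0)\,\mathrm{Bi}(b)-\mathrm{Bi}(0)\,\mathrm{Ai}(b)\big).$$ Take the order $\nu=z$ (spectral parameter $\lambda=0$). Then, as $h\to0$ (that is, $p\to\infty$) with $b$ fixed: 1. $h\,R^{z,p}(z)\to D(b)$. If $D(b)\ne0$, and in particular for every $b>0$, $$R^{z,p}(z)\sim \pi\Big(\frac z2\Big)^{1/3}\big(\mathrm{Ai}(0)\,\mathrm{Bi}(b)-\mathrm{Bi}(0)\,\mathrm{Ai}(b)\big)\qquad\text{and}\qquad R^{z,p}(z)\sim\frac1h\,D(b),$$ where the cube root is the real one. 2. Let $\det(B)$ be the determinant of the discrete operator $y(j)\mapsto -y(j+1)+(2+Bj)\,y(j)-y(j-1)$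 on the vertices $j=1,\dots,p$ with Dirichlet conditions $y(0)=y(p+1)=0$, and $\det(0)$ the determinant of the same operator with the potential term $Bj$ removed. Then $\det(B)/\det(0)\to D(b)$. 3. $D(b)$ is the continuum Gel'fand–Yaglom ratio for the operator $-d^2/dx^2+b^3x$ on $[0,1]$ with Dirichlet conditions: $D(b)=y_1(1)/y_0(1)$, where $y_1''=b^3x\,y_1$, $y_0''=0$, and $y_i(0)=0$, $y_i'(0)=1$ for $i=0,1$. -/

import Mathlib

open Filter Topology Asymptotics

noncomputable section

/-- The solution of `w'' = x w` with `w(0) = 1`, `w'(0) = 0`, as its Maclaurin series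
`∑ 1·4·7⋯(3k-2) x^(3k) / (3k)!`. -/
def airySeriesF (x : ℝ) : ℝ :=
  ∑' k : ℕ, (∏ j ∈ Finset.range k, (3 * (j : ℝ) + 1)) * x ^ (3 * k) / ((3 * k).factorial : ℝ)

/-- The solution of `w'' = x w` with `w(0) = 0`, `w'(0) = 1`, as its Maclaurin series
`∑ 2·5·8⋯(3k-1) x^(3k+1) / (3k+1)!`. -/
def airySeriesG (x : ℝ) : ℝ :=
  ∑' k : ℕ, (∏ j ∈ Finset.range k, (3 * (j : ℝ) + 2)) * x ^ (3 * k + 1) /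
    ((3 * k + 1).factorial : ℝ)

/-- `Ai(0) = 3^(-2/3) / Γ(2/3)`. -/
def airyC₁ : ℝ := (3 : ℝ) ^ (-(2 / 3) : ℝ) / Real.Gamma (2 / 3)

/-- `-Ai'(0) = 3^(-1/3) / Γ(1/3)`. -/
def airyC₂ : ℝ := (3 : ℝ) ^ (-(1 / 3) : ℝ) / Real.Gamma (1 / 3)

/-- The Airy function `Ai` on the real line. -/
def airyAi (x : ℝ) : ℝ := airyC₁ * airySeriesF x - airyC₂ * airySeriesG x

/-- The Airy function `Bi` on the real line. -/
def airyBi (x : ℝ) : ℝ := √3 * (airyC₁ * airySeriesF x + airyC₂ * airySeriesG x)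

/-- The Lommel polynomial `R^{ν,p}(z)` (Nielsen's notation), with the sum over `s < (p+1)/2`,
that is `s ≤ ⌊p/2⌋`.  `Ring.choose` is the generalised binomial coefficient. -/
def lommelR (ν : ℝ) (p : ℕ) (z : ℝ) : ℝ :=
  ∑ s ∈ Finset.range (p / 2 + 1),
    (-1) ^ s * ((p - s).factorial : ℝ) / (s.factorial : ℝ) *
      Ring.choose (ν + ((p - s : ℕ) : ℝ)) (p - 2 * s) * (2 / z) ^ (p - 2 * s)

/-- The step `h = 1/(p+1)` of the discretised unit interval with `p` interior vertices. -/
def pathStep (p : ℕ) : ℝ := 1 / ((p : ℝ) + 1)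

/-- The argument `z = 2/(b h)^3`. -/
def lommelArg (b : ℝ) (p : ℕ) : ℝ := 2 / (b * pathStep p) ^ 3

/-- The discrete Schrödinger operator `-∇Δ + V(j)`,
`y ↦ (-y(j+1) + (2 + V(j)) y(j) - y(j-1))`, on the interior vertices `j = 1, …, p`, with Dirichlet
conditions `y(0) = y(p+1) = 0`. The index `i : Fin p` stands for the vertex `j = i + 1`. -/
def discreteSchrodinger (p : ℕ) (V : ℕ → ℝ) : Matrix (Fin p) (Fin p) ℝ :=
  Matrix.of fun i k =>
    if i = k then 2 + V (i.val + 1)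
    else if i.val + 1 = k.val ∨ k.val + 1 = i.val then -1 else 0

/-- The ratio `det(B)/det(0)` of the determinants with the linear potential `V(j) = B j` and
without a potential. -/
def discreteDetRatio (p : ℕ) (B : ℝ) : ℝ :=
  (discreteSchrodinger p fun j => B * (j : ℝ)).det / (discreteSchrodinger p fun _ => 0).det

/-- `y` is the Gel'fand-Yaglom function of `-d²/dx² + V` on `[0,1]` with Dirichlet conditions:
`-y'' + V y = 0`, `y(0) = 0`, `y'(0) = 1`. -/
def IsGelfandYaglomFunction (V y : ℝ → ℝ) : Prop :=
  ∃ y' : ℝ → ℝ,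
    (∀ x ∈ Set.Icc (0 : ℝ) 1, HasDerivWithinAt y (y' x) (Set.Icc 0 1) x) ∧
    (∀ x ∈ Set.Icc (0 : ℝ) 1, HasDerivWithinAt y' (V x * y x) (Set.Icc 0 1) x) ∧
    y 0 = 0 ∧ y' 0 = 1

/-- `r` is the Gel'fand-Yaglom ratio `y_V(1)/y_0(1)` of the functional determinants with the
potential `V` and without a potential. -/
def IsGelfandYaglomRatio (V : ℝ → ℝ) (r : ℝ) : Prop :=
  ∃ y y₀ : ℝ → ℝ, IsGelfandYaglomFunction V y ∧ IsGelfandYaglomFunction (fun _ => 0) y₀ ∧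
    r = y 1 / y₀ 1

/-- The quantity `(π/b) (Ai(0) Bi(b) - Bi(0) Ai(b))`. -/
def airyRatio (b : ℝ) : ℝ :=
  Real.pi / b * (airyAi 0 * airyBi b - airyBi 0 * airyAi b)

/-- The real cube root. -/
def realCbrt (x : ℝ) : ℝ := Real.sign x * |x| ^ (1 / 3 : ℝ)

end

/-! The determinant and the Lommel polynomial are one sequence. Expanding the tridiagonal
determinant (`discreteSchrodinger_det`) and comparing coefficients in the Lommel sum
(`lommelR_self_eq`) both give `schrodingerSeq` at `p + 1` with potential `B j`; the free determinant
is `p + 1 = 1 / h`.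

Since `B j = h ^ 2 * (b ^ 3 * (j h))`, `h` times this sequence is the central-difference scheme for
`y'' = b ^ 3 x y`, `y 0 = 0`, `y' 0 = 1`. Consistency (`abs_centralDifference_sub_le`) and stability
(`abs_le_of_secondDifference_le`) give convergence to `y 1` in `tendsto_schrodingerSeq`.

Here `y x = airySeriesG (b x) / b`, and `airyRatio_eq` identifies `y 1` with the Airy expression
through the reflection formula for Gamma. For `b > 0` it is nonzero because the series has positive
coefficients. -/

/-! ### Three-term recurrence and tridiagonal determinants. -/

/-- The solution of `s (n + 2) = (2 + W (n + 1)) s (n + 1) - s n` with `s 0 = 0`, `s 1 = 1`. -/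
def schrodingerSeq (W : ℕ → ℝ) : ℕ → ℝ
  | 0 => 0
  | 1 => 1
  | n + 2 => (2 + W (n + 1)) * schrodingerSeq W (n + 1) - schrodingerSeq W n

theorem schrodingerSeq_add_two (W : ℕ → ℝ) (n : ℕ) :
    schrodingerSeq W (n + 2) =
      (2 + W (n + 1)) * schrodingerSeq W (n + 1) - schrodingerSeq W n := rfl

theorem schrodingerSeq_zero_potential (n : ℕ) : schrodingerSeq (fun _ => 0) n = n := by
  induction n using Nat.twoStepInduction with
  | zero => simp [schrodingerSeq]
  | one => simp [schrodingerSeq]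
  | more n h₀ h₁ =>
    rw [schrodingerSeq_add_two, h₀, h₁]
    push_cast
    ring

theorem discreteSchrodinger_submatrix_castSucc (p : ℕ) (V : ℕ → ℝ) :
    (discreteSchrodinger (p + 1) V).submatrix Fin.castSucc Fin.castSucc =
      discreteSchrodinger p V := by
  ext i k
  simp [discreteSchrodinger, Fin.ext_iff]

/-- Laplace expansion along the last row; the off-diagonal minor is then expanded along its last
column, which has a single nonzero entry. -/
theorem discreteSchrodinger_det_add_two (p : ℕ) (V : ℕ → ℝ) :
    (discreteSchrodinger (p + 2) V).det =
      (2 + V (p + 2)) * (discreteSchrodinger (p + 1) V).det - (discreteSchrodinger p V).det := by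
  have hminor : ((discreteSchrodinger (p + 2) V).submatrix Fin.castSucc
      (Fin.last p).castSucc.succAbove).det = -(discreteSchrodinger p V).det := by
    rw [Matrix.det_succ_column _ (Fin.last p), Fin.sum_univ_castSucc, Finset.sum_eq_zero]
    · have hsub : ((discreteSchrodinger (p + 2) V).submatrix Fin.castSucc
          (Fin.last p).castSucc.succAbove).submatrix Fin.castSucc Fin.castSucc =
          discreteSchrodinger p V := by
        ext i k
        have : (Fin.last p).castSucc.succAbove k.castSucc = k.castSucc.castSucc :=
          Fin.succAbove_of_castSucc_lt _ _ (by simp [Fin.lt_def])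
        simp [discreteSchrodinger, this, Fin.ext_iff]
      rw [Fin.succAbove_last, hsub]
      have : (Fin.last p).castSucc.succAbove (Fin.last p) = Fin.last (p + 1) := by
        rw [Fin.succAbove_castSucc_self, Fin.succ_last]
      simp [discreteSchrodinger, this, Fin.ext_iff, ← two_mul]
    · intro i _
      have : (Fin.last p).castSucc.succAbove (Fin.last p) = Fin.last (p + 1) := by
        rw [Fin.succAbove_castSucc_self, Fin.succ_last]
      have hi := i.isLt
      have h₁ : (i : ℕ) ≠ p + 1 := by lia
      have h₂ : (i : ℕ) ≠ p := by lia
      have h₃ : p + 1 + 1 ≠ (i : ℕ) := by lia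
      simp [discreteSchrodinger, this, Fin.ext_iff, h₁, h₂, h₃]
  rw [Matrix.det_succ_row _ (Fin.last (p + 1)), Fin.sum_univ_castSucc, Fin.sum_univ_castSucc,
    Finset.sum_eq_zero]
  · rw [Fin.succAbove_last, hminor, discreteSchrodinger_submatrix_castSucc]
    have hodd : (-1 : ℝ) ^ (p + 1 + p) = -1 := Odd.neg_one_pow ⟨p, by ring⟩
    simp [discreteSchrodinger, Fin.ext_iff, ← two_mul, hodd]
    ring
  · intro i _
    have hi := i.isLt
    have h₁ : p + 1 ≠ (i : ℕ) := by lia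
    have h₂ : p + 1 + 1 ≠ (i : ℕ) := by lia
    have h₃ : (i : ℕ) ≠ p := by lia
    simp [discreteSchrodinger, Fin.ext_iff, h₁, h₂, h₃]

theorem discreteSchrodinger_det (p : ℕ) (V : ℕ → ℝ) :
    (discreteSchrodinger p V).det = schrodingerSeq V (p + 1) := by
  induction p using Nat.twoStepInduction with
  | zero => simp [schrodingerSeq]
  | one => simp [schrodingerSeq, discreteSchrodinger]
  | more p h₀ h₁ =>
    rw [discreteSchrodinger_det_add_two, h₀, h₁, schrodingerSeq_add_two V (p + 1)]

theorem discreteDetRatio_eq (p : ℕ) (B : ℝ) :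
    discreteDetRatio p B = pathStep p * schrodingerSeq (fun j => B * j) (p + 1) := by
  rw [discreteDetRatio, discreteSchrodinger_det, discreteSchrodinger_det,
    schrodingerSeq_zero_potential, pathStep]
  push_cast
  ring

/-! ### Lommel polynomials. -/

/-- The coefficient of `(2 / z) ^ (p - 2 s)` in the Lommel polynomial, up to sign. -/
noncomputable def lommelCoeff (ν : ℝ) (p s : ℕ) : ℝ :=
  ((p - s).choose s : ℝ) * (ascPochhammer ℝ (p - 2 * s)).eval (ν + s + 1)

theorem ascPochhammer_eval_succ_left (n : ℕ) (x : ℝ) :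
    (ascPochhammer ℝ (n + 1)).eval x = x * (ascPochhammer ℝ n).eval (x + 1) := by
  rw [ascPochhammer_succ_left]
  simp

theorem lommelCoeff_eq {p s : ℕ} (ν : ℝ) (h : 2 * s ≤ p) :
    ((p - s).factorial : ℝ) / (s.factorial : ℝ) *
      Ring.choose (ν + ((p - s : ℕ) : ℝ)) (p - 2 * s) = lommelCoeff ν p s := by
  obtain ⟨m, rfl⟩ := Nat.exists_eq_add_of_le h
  have e₁ : 2 * s + m - s = s + m := by lia
  have e₂ : 2 * s + m - 2 * s = m := by lia
  rw [lommelCoeff, e₁, e₂, Ring.choose]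
  have hx : ν + ((s + m : ℕ) : ℝ) - m + 1 = ν + s + 1 := by
    push_cast
    ring
  have key := Ring.factorial_nsmul_multichoose_eq_ascPochhammer (ν + s + 1 : ℝ) m
  rw [Polynomial.ascPochhammer_smeval_eq_eval, nsmul_eq_mul] at key
  have hc : ((s + m).choose s : ℝ) * s.factorial * m.factorial = (s + m).factorial := by
    rw [Nat.choose_symm_add]
    exact_mod_cast Nat.add_choose_mul_factorial_mul_factorial s m
  rw [hx, ← key, ← hc]
  field_simp

/-- A free upper limit `N` lets three consecutive polynomials be summed over comparable ranges; the
extra terms vanish with `(p - s).choose s`. -/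
theorem lommelR_eq_sum (ν : ℝ) (p : ℕ) (z : ℝ) {N : ℕ} (hN : p / 2 < N) :
    lommelR ν p z = ∑ s ∈ Finset.range N,
      (-1) ^ s * lommelCoeff ν p s * (2 / z) ^ (p - 2 * s) := by
  rw [← Finset.sum_subset (Finset.range_subset_range.2 (Nat.succ_le_of_lt hN))]
  · refine Finset.sum_congr rfl fun s hs => ?_
    have : 2 * s ≤ p := by
      rw [Finset.mem_range] at hs
      lia
    rw [← lommelCoeff_eq ν this]
    ring
  · intro s _ hs
    have : p - s < s := by
      rw [Finset.mem_range] at hs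
      lia
    simp [lommelCoeff, Nat.choose_eq_zero_of_lt this]

/-- Pascal's rule, after the Pochhammer symbols are reduced to a common factor by splitting one off
at its lower end and another at its upper end. -/
theorem lommelCoeff_succ_mul_pow {p s : ℕ} (ν x : ℝ) (h : 2 * s ≤ p) :
    lommelCoeff ν (p + 2) (s + 1) * x ^ (p + 2 - 2 * (s + 1)) =
      x * (ν + p + 2) * (lommelCoeff ν (p + 1) (s + 1) * x ^ (p + 1 - 2 * (s + 1))) +
        lommelCoeff ν p s * x ^ (p - 2 * s) := by
  obtain ⟨m, rfl⟩ := Nat.exists_eq_add_of_le h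
  have e₁ : 2 * s + m + 2 - (s + 1) = s + m + 1 := by lia
  have e₂ : 2 * s + m + 2 - 2 * (s + 1) = m := by lia
  have e₃ : 2 * s + m + 1 - (s + 1) = s + m := by lia
  have e₄ : 2 * s + m - s = s + m := by lia
  have e₅ : 2 * s + m - 2 * s = m := by lia
  simp only [lommelCoeff, e₁, e₂, e₃, e₄, e₅]
  cases m with
  | zero => simp
  | succ m =>
    have e₆ : 2 * s + (m + 1) + 1 - 2 * (s + 1) = m := by lia
    have hc : ((s + (m + 1)).choose (s + 1) : ℝ) * (s + 1) =
        ((s + (m + 1)).choose s : ℝ) * (m + 1) := by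
      have := Nat.choose_succ_right_eq (s + (m + 1)) s
      rw [show s + (m + 1) - s = m + 1 by lia] at this
      exact_mod_cast this
    rw [e₆, Nat.choose_succ_succ (s + (m + 1)) s, ascPochhammer_eval_succ_left m (ν + s + 1),
      ascPochhammer_succ_eval]
    push_cast
    rw [show ν + (s + 1 : ℝ) + 1 = ν + s + 1 + 1 by ring]
    linear_combination (-(ascPochhammer ℝ m).eval (ν + s + 1 + 1) * x ^ (m + 1)) * hc

theorem lommelR_add_two (ν : ℝ) (p : ℕ) (z : ℝ) :
    lommelR ν (p + 2) z =
      2 / z * (ν + p + 2) * lommelR ν (p + 1) z - lommelR ν p z := by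
  have h₂ : (p + 2) / 2 < p / 2 + 1 + 1 := by lia
  have h₁ : (p + 1) / 2 < p / 2 + 1 + 1 := by lia
  rw [lommelR_eq_sum ν (p + 2) z h₂, lommelR_eq_sum ν (p + 1) z h₁,
    lommelR_eq_sum ν p z (Nat.lt_succ_self _), Finset.sum_range_succ' _ (p / 2 + 1),
    Finset.sum_range_succ' _ (p / 2 + 1), mul_add, Finset.mul_sum, add_sub_right_comm,
    ← Finset.sum_sub_distrib]
  congr 1
  · refine Finset.sum_congr rfl fun s hs => ?_
    have h : 2 * s ≤ p := by
      rw [Finset.mem_range] at hs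
      lia
    linear_combination (-1) ^ (s + 1) * lommelCoeff_succ_mul_pow ν (2 / z) h
  · simp only [lommelCoeff, Nat.choose_zero_right, mul_zero, Nat.sub_zero,
      ascPochhammer_succ_eval (S := ℝ) (p + 1)]
    push_cast
    ring

/-- The choice `ν = z` turns the factor `2 / z * (ν + p + 2)` into `2 + (2 / z) * (p + 2)`. -/
theorem lommelR_self_eq {z : ℝ} (hz : z ≠ 0) (p : ℕ) :
    lommelR z p z = schrodingerSeq (fun j => 2 / z * j) (p + 1) := by
  induction p using Nat.twoStepInduction with
  | zero => simp [lommelR, schrodingerSeq]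
  | one =>
    simp [lommelR, schrodingerSeq]
    field_simp
  | more p h₀ h₁ =>
    rw [lommelR_add_two, h₀, h₁, schrodingerSeq_add_two _ (p + 1)]
    push_cast
    field_simp
    ring

/-! ### Consistency and stability of the difference scheme. -/

/-- The Lipschitz bound on the second derivative is integrated twice in the symmetric increment. The
order `h ^ 3` suffices: about `1 / h` steps, with the stability factor `1 / h`, leave an error
`O(h)`. -/
theorem abs_centralDifference_sub_le {y y₁ y₂ : ℝ → ℝ} {L : ℝ}
    (hy : ∀ x, HasDerivAt y (y₁ x) x) (hy₁ : ∀ x, HasDerivAt y₁ (y₂ x) x)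
    (hL : ∀ x ∈ Set.Icc (0 : ℝ) 1, ∀ t ∈ Set.Icc (0 : ℝ) 1, |y₂ x - y₂ t| ≤ L * |x - t|)
    (hL₀ : 0 ≤ L) {x h : ℝ} (hh : 0 ≤ h) (hx₀ : 0 ≤ x - h) (hx₁ : x + h ≤ 1) :
    |y (x + h) - 2 * y x + y (x - h) - h ^ 2 * y₂ x| ≤ 2 * L * h ^ 3 := by
  have hadd : ∀ t, HasDerivAt (fun t => x + t) 1 t := fun t => (hasDerivAt_id t).const_add x
  have hsub : ∀ t, HasDerivAt (fun t => x - t) (-1) t := fun t => (hasDerivAt_id t).const_sub x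
  have hb₂ : ∀ t ∈ Set.Icc 0 h, |y₂ (x + t) + y₂ (x - t) - 2 * y₂ x| ≤ 2 * L * h := by
    intro t ⟨ht₀, ht⟩
    have h₁ := hL (x + t) ⟨by linarith, by linarith⟩ x ⟨by linarith, by linarith⟩
    have h₂ := hL (x - t) ⟨by linarith, by linarith⟩ x ⟨by linarith, by linarith⟩
    rw [show x + t - x = t by ring, abs_of_nonneg ht₀] at h₁
    rw [show x - t - x = -t by ring, abs_neg, abs_of_nonneg ht₀] at h₂
    have h₃ := abs_add_le (y₂ (x + t) - y₂ x) (y₂ (x - t) - y₂ x)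
    have h₄ := mul_le_mul_of_nonneg_left ht hL₀
    rw [show y₂ (x + t) + y₂ (x - t) - 2 * y₂ x =
      (y₂ (x + t) - y₂ x) + (y₂ (x - t) - y₂ x) by ring]
    linarith
  have hb₁ : ∀ t ∈ Set.Icc 0 h, |y₁ (x + t) - y₁ (x - t) - 2 * t * y₂ x| ≤ 2 * L * h * h := by
    intro t ht
    have hd : ∀ s ∈ Set.Icc 0 h, HasDerivWithinAt
        (fun s => y₁ (x + s) - y₁ (x - s) - 2 * s * y₂ x)
        (y₂ (x + s) + y₂ (x - s) - 2 * y₂ x) (Set.Icc 0 h) s := by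
      intro s _
      have := (((hy₁ (x + s)).comp s (hadd s)).sub ((hy₁ (x - s)).comp s (hsub s))).sub
        (((hasDerivAt_id s).const_mul 2).mul_const (y₂ x))
      exact (this.congr_deriv (by ring)).hasDerivWithinAt
    have := norm_image_sub_le_of_norm_deriv_le_segment' hd
      (fun s hs => hb₂ s ⟨hs.1, hs.2.le⟩) t ht
    simp only [Real.norm_eq_abs, add_zero, sub_zero, mul_zero, zero_mul, sub_self] at this
    exact this.trans (mul_le_mul_of_nonneg_left ht.2 (by positivity))
  have hd : ∀ s ∈ Set.Icc 0 h, HasDerivWithinAt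
      (fun s => y (x + s) + y (x - s) - s ^ 2 * y₂ x)
      (y₁ (x + s) - y₁ (x - s) - 2 * s * y₂ x) (Set.Icc 0 h) s := by
    intro s _
    have := (((hy (x + s)).comp s (hadd s)).add ((hy (x - s)).comp s (hsub s))).sub
      (((hasDerivAt_id s).pow 2).mul_const (y₂ x))
    exact (this.congr_deriv (by simp; ring)).hasDerivWithinAt
  have := norm_image_sub_le_of_norm_deriv_le_segment' hd
    (fun s hs => hb₁ s ⟨hs.1, hs.2.le⟩) h ⟨hh, le_rfl⟩
  simp only [Real.norm_eq_abs, add_zero, sub_zero] at this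
  calc _ = |y (x + h) + y (x - h) - h ^ 2 * y₂ x - (y x + y x - 0 ^ 2 * y₂ x)| := by
        congr 1
        ring
    _ ≤ _ := this
    _ = _ := by ring

/-- Discrete Grönwall inequality for the energy `|e (n + 1)| + |e (n + 1) - e n| / h`, which
controls the value and the difference quotient together. -/
theorem abs_le_of_secondDifference_le {e : ℕ → ℝ} {h K C : ℝ} {p : ℕ} (hh : 0 < h) (hh₁ : h ≤ 1)
    (hp : p * h ≤ 1) (hK : 0 ≤ K) (hC : 0 ≤ C) (he₀ : e 0 = 0)
    (he : ∀ n < p, |e (n + 2) - 2 * e (n + 1) + e n| ≤ h ^ 2 * K * |e (n + 1)| + C * h ^ 3) :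
    |e (p + 1)| ≤ Real.exp (2 * K + 1) * (2 * (|e 1| / h) + 2 * C * h) := by
  -- One step costs at most `2 * K * h` times the value (using `h ^ 2 ≤ h`) and `h` times the
  -- difference quotient.
  set c := 2 * K + 1 with hc
  have hc₀ : 0 ≤ c := by positivity
  have key : ∀ n ≤ p, |e (n + 1)| + |e (n + 1) - e n| / h ≤
      (1 + c * h) ^ n * (2 * (|e 1| / h) + n * (2 * C * h ^ 2)) := by
    intro n
    induction n with
    | zero =>
      intro _
      have : |e 1| ≤ |e 1| / h := le_div_self (abs_nonneg _) hh hh₁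
      simp [he₀]
      linarith
    | succ n ih =>
      intro hn
      have ih := ih (by lia)
      have hn' := he n (by lia)
      set E := |e (n + 1)| + |e (n + 1) - e n| / h with hE
      set d := |e (n + 1) - e n| / h with hd
      have hdh : |e (n + 1) - e n| = d * h := by
        rw [hd]
        field_simp
      have hd₀ : 0 ≤ d := by positivity
      have h₁ : |e (n + 2) - e (n + 1)| ≤ d * h + (h ^ 2 * K * |e (n + 1)| + C * h ^ 3) := by
        calc |e (n + 2) - e (n + 1)|
            = |(e (n + 1) - e n) + (e (n + 2) - 2 * e (n + 1) + e n)| := by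
              congr 1
              ring
          _ ≤ _ := (abs_add_le _ _).trans (by linarith)
      have h₂ : |e (n + 2)| ≤ |e (n + 1)| + |e (n + 2) - e (n + 1)| := by
        have := abs_add_le (e (n + 1)) (e (n + 2) - e (n + 1))
        rwa [add_sub_cancel] at this
      have h₃ : |e (n + 2) - e (n + 1)| / h ≤ d + h * K * |e (n + 1)| + C * h ^ 2 := by
        rw [div_le_iff₀ hh]
        linarith
      have hsq : h ^ 2 ≤ h := by nlinarith
      have hcu : h ^ 3 ≤ h ^ 2 := by nlinarith [sq_nonneg h]
      have hstep : |e (n + 2)| + |e (n + 2) - e (n + 1)| / h ≤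
          (1 + c * h) * E + 2 * C * h ^ 2 := by
        have a₁ := mul_le_mul_of_nonneg_left hcu hC
        have a₂ : h ^ 2 * (K * |e (n + 1)|) ≤ h * (K * |e (n + 1)|) :=
          mul_le_mul_of_nonneg_right hsq (by positivity)
        have a₃ : 0 ≤ h * |e (n + 1)| := by positivity
        have a₄ : 0 ≤ h * (K * d) := by positivity
        rw [hE, hc]
        linarith
      have hpow : 1 ≤ (1 + c * h) ^ (n + 1) :=
        one_le_pow₀ (le_add_of_nonneg_right (by positivity))
      calc |e (n + 1 + 1)| + |e (n + 1 + 1) - e (n + 1)| / h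
          ≤ (1 + c * h) * E + 2 * C * h ^ 2 := hstep
        _ ≤ (1 + c * h) * ((1 + c * h) ^ n * (2 * (|e 1| / h) + n * (2 * C * h ^ 2))) +
            (1 + c * h) ^ (n + 1) * (2 * C * h ^ 2) := by
          refine add_le_add (mul_le_mul_of_nonneg_left ih (by positivity)) ?_
          exact le_mul_of_one_le_left (by positivity) hpow
        _ = _ := by
          push_cast
          ring
  calc |e (p + 1)| ≤ |e (p + 1)| + |e (p + 1) - e p| / h :=
        le_add_of_nonneg_right (by positivity)
    _ ≤ (1 + c * h) ^ p * (2 * (|e 1| / h) + p * (2 * C * h ^ 2)) := key p le_rfl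
    _ ≤ Real.exp c * (2 * (|e 1| / h) + 2 * C * h) := by
      refine mul_le_mul ?_ ?_ (by positivity) (Real.exp_pos _).le
      · calc (1 + c * h) ^ p ≤ Real.exp (c * h) ^ p := by
              refine pow_le_pow_left₀ (by positivity) ?_ p
              linarith [Real.add_one_le_exp (c * h)]
          _ = Real.exp (c * (p * h)) := by
              rw [← Real.exp_nat_mul]
              ring_nf
          _ ≤ Real.exp c := Real.exp_le_exp.2 (mul_le_of_le_one_right hc₀ hp)
      · have := mul_le_mul_of_nonneg_right hp (show 0 ≤ 2 * C * h by positivity)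
        linarith

/-! ### The Airy series and its differential equation. -/

/-- The Maclaurin coefficients of `airySeriesG`. -/
noncomputable def airyCoeffG (k : ℕ) : ℝ :=
  (∏ j ∈ Finset.range k, (3 * (j : ℝ) + 2)) / ((3 * k + 1).factorial : ℝ)

theorem airyCoeffG_zero : airyCoeffG 0 = 1 := by simp [airyCoeffG]

theorem airyCoeffG_pos (k : ℕ) : 0 < airyCoeffG k :=
  div_pos (Finset.prod_pos fun j _ => by positivity) (by positivity)

theorem airyCoeffG_succ (k : ℕ) :
    (3 * k + 4) * (3 * k + 3) * airyCoeffG (k + 1) = airyCoeffG k := by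
  have hf : ((3 * (k + 1) + 1).factorial : ℝ) =
      (3 * k + 4) * (3 * k + 3) * (3 * k + 2) * (3 * k + 1).factorial := by
    rw [show 3 * (k + 1) + 1 = 3 * k + 1 + 1 + 1 + 1 by ring, Nat.factorial_succ,
      Nat.factorial_succ, Nat.factorial_succ]
    push_cast
    ring
  have : (0 : ℝ) < 3 * k + 2 := by positivity
  rw [airyCoeffG, airyCoeffG, Finset.prod_range_succ, hf]
  field_simp

/-- This crude bound and the next two majorise the series of both termwise derivatives by `R ^ (3 *
k) / k!`. -/
theorem airyCoeffG_le (k : ℕ) : airyCoeffG k ≤ 1 / ((k + 1).factorial : ℝ) := by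
  induction k with
  | zero => simp [airyCoeffG_zero]
  | succ k ih =>
    rw [← airyCoeffG_succ, le_div_iff₀ (by positivity)] at ih
    rw [le_div_iff₀ (by positivity), Nat.factorial_succ]
    refine le_trans ?_ ih
    have h := mul_pos (airyCoeffG_pos (k + 1)) (show (0 : ℝ) < (k + 1).factorial by positivity)
    have hk : (0 : ℝ) ≤ k := k.cast_nonneg
    push_cast
    nlinarith [mul_nonneg hk h.le, mul_nonneg hk (mul_nonneg hk h.le)]

theorem three_mul_mul_airyCoeffG_le (k : ℕ) :
    3 * k * ((3 * k + 1) * airyCoeffG k) ≤ 1 / (k.factorial : ℝ) := by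
  cases k with
  | zero => simp
  | succ k =>
    refine le_trans (le_of_eq ?_) (airyCoeffG_le k)
    rw [← airyCoeffG_succ k]
    push_cast
    ring

theorem mul_airyCoeffG_le (k : ℕ) : (3 * k + 1) * airyCoeffG k ≤ 1 / (k.factorial : ℝ) := by
  cases k with
  | zero => simp [airyCoeffG_zero]
  | succ k =>
    refine le_trans ?_ (three_mul_mul_airyCoeffG_le (k + 1))
    refine le_mul_of_one_le_left ?_ ?_
    · exact mul_nonneg (by positivity) (airyCoeffG_pos _).le
    · push_cast
      linarith [(k.cast_nonneg : (0 : ℝ) ≤ k)]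

theorem airySeriesG_eq (x : ℝ) : airySeriesG x = ∑' k, airyCoeffG k * x ^ (3 * k + 1) :=
  tsum_congr fun k => by rw [airyCoeffG]; ring

/-- The termwise derivative of `airySeriesG`. -/
noncomputable def airySeriesGDeriv (x : ℝ) : ℝ :=
  ∑' k : ℕ, (3 * k + 1) * airyCoeffG k * x ^ (3 * k)

theorem summable_pow_three_mul_div_factorial (R : ℝ) :
    Summable fun k : ℕ => R ^ (3 * k) / (k.factorial : ℝ) := by
  simpa only [pow_mul] using Real.summable_pow_div_factorial (R ^ 3)

theorem hasDerivAt_airySeriesG (x : ℝ) : HasDerivAt airySeriesG (airySeriesGDeriv x) x := by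
  have := hasDerivAt_tsum_of_isPreconnected (t := Metric.ball 0 (|x| + 1)) (y₀ := 0) (y := x)
    (g := fun (k : ℕ) (y : ℝ) => airyCoeffG k * y ^ (3 * k + 1))
    (g' := fun (k : ℕ) (y : ℝ) => (3 * k + 1) * airyCoeffG k * y ^ (3 * k))
    (summable_pow_three_mul_div_factorial (|x| + 1)) Metric.isOpen_ball
    (convex_ball _ _).isPreconnected ?_ ?_ (by simp; positivity) (by simp) (by simp)
  · exact this.congr_of_eventuallyEq (Eventually.of_forall airySeriesG_eq)
  · intro k y _
    refine ((hasDerivAt_pow (3 * k + 1) y).const_mul (airyCoeffG k)).congr_deriv ?_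
    simp
    ring
  · intro k y hy
    rw [mem_ball_zero_iff, Real.norm_eq_abs] at hy
    have h₀ : 0 ≤ (3 * k + 1) * airyCoeffG k := mul_nonneg (by positivity) (airyCoeffG_pos k).le
    rw [Real.norm_eq_abs, abs_mul, abs_pow, abs_of_nonneg h₀, div_eq_mul_one_div, mul_comm]
    exact mul_le_mul (pow_le_pow_left₀ (abs_nonneg y) hy.le _) (mul_airyCoeffG_le k) h₀
      (by positivity)

theorem hasDerivAt_airySeriesGDeriv (x : ℝ) :
    HasDerivAt airySeriesGDeriv (x * airySeriesG x) x := by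
  -- The added `1` puts `x` inside the open ball and makes `R ≥ 1`, so the exponent `3 * k - 1` may
  -- be raised to `3 * k`.
  set R := |x| + 1 with hR
  have hR₁ : 1 ≤ R := by simp [hR]
  have hbound : ∀ (k : ℕ), ∀ y ∈ Metric.ball (0 : ℝ) R,
      ‖3 * k * ((3 * k + 1) * airyCoeffG k) * y ^ (3 * k - 1)‖ ≤
        R ^ (3 * k) / (k.factorial : ℝ) := by
    intro k y hy
    rw [mem_ball_zero_iff, Real.norm_eq_abs] at hy
    have h₀ : 0 ≤ 3 * k * ((3 * k + 1) * airyCoeffG k) :=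
      mul_nonneg (by positivity) (mul_nonneg (by positivity) (airyCoeffG_pos k).le)
    rw [Real.norm_eq_abs, abs_mul, abs_pow, abs_of_nonneg h₀, div_eq_mul_one_div, mul_comm]
    refine mul_le_mul ?_ (three_mul_mul_airyCoeffG_le k) h₀ (by positivity)
    exact (pow_le_pow_left₀ (abs_nonneg y) hy.le _).trans
      (pow_le_pow_right₀ hR₁ (Nat.sub_le _ _))
  have hx : x ∈ Metric.ball (0 : ℝ) R := by simp [hR]
  have := hasDerivAt_tsum_of_isPreconnected (t := Metric.ball 0 R) (y₀ := 0) (y := x)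
    (g := fun (k : ℕ) (y : ℝ) => (3 * k + 1) * airyCoeffG k * y ^ (3 * k))
    (g' := fun (k : ℕ) (y : ℝ) => 3 * k * ((3 * k + 1) * airyCoeffG k) * y ^ (3 * k - 1))
    (summable_pow_three_mul_div_factorial R) Metric.isOpen_ball
    (convex_ball _ _).isPreconnected ?_ hbound (by simp; positivity) ?_ hx
  · refine this.congr_deriv ?_
    have hs : Summable fun k : ℕ =>
        3 * k * ((3 * k + 1) * airyCoeffG k) * x ^ (3 * k - 1) :=
      .of_norm_bounded (summable_pow_three_mul_div_factorial R) fun k => hbound k x hx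
    -- The term `k = 0` vanishes, truncated exponent included; shifting the index then matches the
    -- coefficient recurrence.
    rw [hs.tsum_eq_zero_add, airySeriesG_eq, ← tsum_mul_left]
    simp only [Nat.cast_zero, mul_zero, zero_mul, zero_add]
    refine tsum_congr fun k => ?_
    rw [← airyCoeffG_succ k, show 3 * (k + 1) - 1 = 3 * k + 1 + 1 by lia, pow_succ x (3 * k + 1)]
    push_cast
    ring
  · intro k y _
    refine ((hasDerivAt_pow (3 * k) y).const_mul ((3 * k + 1) * airyCoeffG k)).congr_deriv ?_
    push_cast
    ring
  · refine summable_of_ne_finset_zero (s := {0}) fun k hk => ?_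
    rw [Finset.mem_singleton] at hk
    simp [hk]

theorem airySeriesG_zero : airySeriesG 0 = 0 := by simp [airySeriesG]

theorem airySeriesF_zero : airySeriesF 0 = 1 := by
  rw [airySeriesF, tsum_eq_single 0]
  · simp
  · intro k hk
    simp [hk]

theorem airySeriesGDeriv_zero : airySeriesGDeriv 0 = 1 := by
  rw [airySeriesGDeriv, tsum_eq_single 0]
  · simp [airyCoeffG_zero]
  · intro k hk
    simp [hk]

theorem airySeriesG_pos {x : ℝ} (hx : 0 < x) : 0 < airySeriesG x := by
  rw [airySeriesG_eq]
  have hnn : ∀ k, 0 ≤ airyCoeffG k * x ^ (3 * k + 1) := fun k =>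
    mul_nonneg (airyCoeffG_pos k).le (by positivity)
  refine Summable.tsum_pos ?_ hnn 0 (by simpa [airyCoeffG_zero] using hx)
  refine .of_nonneg_of_le hnn (fun k => ?_)
    ((summable_pow_three_mul_div_factorial x).mul_right x)
  have h₁ := (le_mul_of_one_le_left (airyCoeffG_pos k).le
    (show (1 : ℝ) ≤ 3 * k + 1 by simp)).trans (mul_airyCoeffG_le k)
  calc airyCoeffG k * x ^ (3 * k + 1) ≤ 1 / (k.factorial : ℝ) * x ^ (3 * k + 1) :=
        mul_le_mul_of_nonneg_right h₁ (by positivity)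
    _ = _ := by ring

theorem airyC₁_mul_airyC₂ : airyC₁ * airyC₂ = √3 / (6 * Real.pi) := by
  have hG := Real.Gamma_mul_Gamma_one_sub (1 / 3)
  rw [show (1 : ℝ) - 1 / 3 = 2 / 3 by norm_num, mul_one_div, Real.sin_pi_div_three] at hG
  have h3 : (3 : ℝ) ^ (-(2 / 3) : ℝ) * (3 : ℝ) ^ (-(1 / 3) : ℝ) = 1 / 3 := by
    rw [← Real.rpow_add (by norm_num), show (-(2 / 3) + -(1 / 3) : ℝ) = -1 by norm_num,
      Real.rpow_neg_one]
    norm_num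
  have hs : √3 * √3 = 3 := Real.mul_self_sqrt (by norm_num)
  have hs₀ : √3 ≠ 0 := by positivity
  rw [airyC₁, airyC₂, div_mul_div_comm, h3, mul_comm (Real.Gamma (2 / 3)), hG]
  field_simp
  linarith

/-- The `airySeriesF` terms cancel, leaving `2 √3 c₁ c₂ airySeriesG b` with `2 √3 c₁ c₂ = 1 / π`. -/
theorem airyRatio_eq (b : ℝ) : airyRatio b = airySeriesG b / b := by
  have hs : √3 * √3 = 3 := Real.mul_self_sqrt (by norm_num)
  have hD : airyAi 0 * airyBi b - airyBi 0 * airyAi b = airySeriesG b / Real.pi := by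
    rw [airyAi, airyAi, airyBi, airyBi, airySeriesF_zero, airySeriesG_zero]
    calc _ = 2 * √3 * (airyC₁ * airyC₂) * airySeriesG b := by ring
      _ = (√3 * √3) / 3 * airySeriesG b / Real.pi := by
        rw [airyC₁_mul_airyC₂]
        field_simp
        ring
      _ = _ := by
        rw [hs]
        ring
  rw [airyRatio, hD]
  field_simp

/-! ### Convergence of the scheme. -/

theorem pathStep_pos (p : ℕ) : 0 < pathStep p := by
  rw [pathStep]
  positivity

theorem succ_mul_pathStep (p : ℕ) : ((p : ℝ) + 1) * pathStep p = 1 := by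
  rw [pathStep]
  field_simp

theorem tendsto_pathStep : Tendsto pathStep atTop (𝓝 0) :=
  tendsto_one_div_add_atTop_nhds_zero_nat

/-- The finite difference scheme for `y'' = V y`, `y 0 = 0`, `y' 0 = 1` on `[0, 1]` converges. -/
theorem tendsto_schrodingerSeq {V y y₁ : ℝ → ℝ} (hV : ContDiff ℝ 1 V)
    (hy : ∀ x, HasDerivAt y (y₁ x) x) (hy₁ : ∀ x, HasDerivAt y₁ (V x * y x) x)
    (hy₀ : y 0 = 0) (hy₁₀ : y₁ 0 = 1) :
    Tendsto (fun p : ℕ => pathStep p *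
      schrodingerSeq (fun j => pathStep p ^ 2 * V (j * pathStep p)) (p + 1)) atTop
      (𝓝 (y 1)) := by
  have hyd : ContDiff ℝ 1 y := by
    rw [contDiff_one_iff_deriv]
    refine ⟨fun x => (hy x).differentiableAt, ?_⟩
    rw [show deriv y = y₁ from funext fun x => (hy x).deriv]
    exact continuous_iff_continuousAt.2 fun x => (hy₁ x).continuousAt
  obtain ⟨L, hL⟩ := (hV.mul hyd).contDiffOn.exists_lipschitzOnWith one_ne_zero
    (convex_Icc (0 : ℝ) 1) isCompact_Icc
  have hL' : ∀ x ∈ Set.Icc (0 : ℝ) 1, ∀ t ∈ Set.Icc (0 : ℝ) 1,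
      |V x * y x - V t * y t| ≤ L * |x - t| := fun x hx t ht => by
    simpa [Real.dist_eq] using hL.dist_le_mul x hx t ht
  obtain ⟨K, hK⟩ := isCompact_Icc.exists_bound_of_continuousOn
    (hV.continuous.continuousOn (s := Set.Icc (0 : ℝ) 1))
  have hK₀ : 0 ≤ K := (norm_nonneg _).trans (hK 0 (by simp))
  have herr : ∀ p : ℕ, |y 1 - pathStep p *
      schrodingerSeq (fun j => pathStep p ^ 2 * V (j * pathStep p)) (p + 1)| ≤
      Real.exp (2 * K + 1) *
        (2 * (|y (pathStep p) / pathStep p - 1|) + 2 * (2 * L) * pathStep p) := by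
    intro p
    set h := pathStep p
    have hh : 0 < h := pathStep_pos p
    have hph : ((p : ℝ) + 1) * h = 1 := succ_mul_pathStep p
    have hp₀ : 0 ≤ p * h := by positivity
    set s := schrodingerSeq (fun j => h ^ 2 * V (j * h)) with hs
    have key := abs_le_of_secondDifference_le (e := fun n : ℕ => y (n * h) - h * s n)
      (K := K) (C := 2 * L) (p := p) hh (by linarith) (by linarith) hK₀ (by positivity)
      (by simp [hy₀, hs, schrodingerSeq]) ?_
    · have h₁ : |y ((1 : ℕ) * h) - h * s 1| / h = |y h / h - 1| := by
        rw [← abs_of_pos hh, ← abs_div, abs_of_pos hh]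
        congr 1
        simp only [hs, schrodingerSeq, Nat.cast_one, one_mul, mul_one]
        field_simp
      simp only [h₁] at key
      push_cast at key
      rwa [hph] at key
    · intro n hn
      have hnp : ((n : ℝ) + 2) * h ≤ 1 := by
        rw [← hph]
        refine mul_le_mul_of_nonneg_right ?_ hh.le
        have : ((n + 1 : ℕ) : ℝ) ≤ p := by exact_mod_cast hn
        push_cast at this
        linarith
      have hn₀ : 0 ≤ n * h := by positivity
      have hτ := abs_centralDifference_sub_le hy hy₁ hL' L.2 (x := (n + 1) * h) hh.le
        (by linarith) (by linarith)
      have hKn := hK ((n + 1) * h) ⟨by positivity, by linarith⟩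
      rw [Real.norm_eq_abs] at hKn
      have hsn : s (n + 2) = (2 + h ^ 2 * V ((n + 1) * h)) * s (n + 1) - s n := by
        rw [hs, schrodingerSeq_add_two]
        push_cast
        rfl
      rw [show ((n : ℝ) + 1) * h + h = (n + 2) * h by ring,
        show ((n : ℝ) + 1) * h - h = n * h by ring] at hτ
      push_cast
      set x := ((n : ℝ) + 1) * h
      -- The error obeys the scheme itself, with the truncation error as forcing term.
      have hsplit : y ((n + 2) * h) - h * s (n + 2) - 2 * (y x - h * s (n + 1)) +
          (y (n * h) - h * s n) = h ^ 2 * (V x * (y x - h * s (n + 1))) +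
          (y ((n + 2) * h) - 2 * y x + y (n * h) - h ^ 2 * (V x * y x)) := by
        rw [hsn]
        ring
      rw [hsplit]
      refine (abs_add_le _ _).trans (add_le_add ?_ hτ)
      rw [abs_mul, abs_mul, abs_of_nonneg (sq_nonneg h), mul_assoc]
      gcongr
  -- The initial error divided by `h` is `y h / h - 1`, which vanishes in the limit because `y' 0 =
  -- 1`.
  have hslope : Tendsto (fun p => y (pathStep p) / pathStep p) atTop (𝓝 1) := by
    have := hasDerivAt_iff_tendsto_slope.1 (hy₁₀ ▸ hy 0)
    refine (this.comp (tendsto_nhdsWithin_iff.2 ⟨tendsto_pathStep, Eventually.of_forall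
      fun p => (pathStep_pos p).ne'⟩)).congr fun p => ?_
    simp [slope_def_field, hy₀]
  have hlim : Tendsto (fun p => Real.exp (2 * K + 1) *
      (2 * (|y (pathStep p) / pathStep p - 1|) + 2 * (2 * L) * pathStep p)) atTop (𝓝 0) := by
    have := ((((hslope.sub_const 1).abs.const_mul 2).add
      (tendsto_pathStep.const_mul (2 * (2 * (L : ℝ))))).const_mul (Real.exp (2 * K + 1)))
    simpa using this
  refine tendsto_iff_dist_tendsto_zero.2
    (squeeze_zero (fun _ => dist_nonneg) (fun p => ?_) hlim)
  rw [dist_comm, Real.dist_eq]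
  exact herr p

/-! ### The linear potential and the main theorem. -/

theorem hasDerivAt_airySeriesG_scaled {b : ℝ} (hb : b ≠ 0) (x : ℝ) :
    HasDerivAt (fun x => airySeriesG (b * x) / b) (airySeriesGDeriv (b * x)) x := by
  have := ((hasDerivAt_airySeriesG (b * x)).comp x ((hasDerivAt_id x).const_mul b)).div_const b
  exact this.congr_deriv (by field_simp)

theorem hasDerivAt_airySeriesGDeriv_scaled {b : ℝ} (hb : b ≠ 0) (x : ℝ) :
    HasDerivAt (fun x => airySeriesGDeriv (b * x))
      (b ^ 3 * x * (airySeriesG (b * x) / b)) x := by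
  have := (hasDerivAt_airySeriesGDeriv (b * x)).comp x ((hasDerivAt_id x).const_mul b)
  exact this.congr_deriv (by field_simp)

theorem tendsto_schrodingerSeq_linear {b : ℝ} (hb : b ≠ 0) :
    Tendsto (fun p : ℕ => pathStep p *
      schrodingerSeq (fun j => (b * pathStep p) ^ 3 * j) (p + 1)) atTop (𝓝 (airyRatio b)) := by
  have := tendsto_schrodingerSeq (V := fun x => b ^ 3 * x) (by fun_prop)
    (hasDerivAt_airySeriesG_scaled hb) (hasDerivAt_airySeriesGDeriv_scaled hb)
    (by simp [airySeriesG_zero]) (by simp [airySeriesGDeriv_zero])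
  rw [mul_one, ← airyRatio_eq] at this
  refine this.congr fun p => ?_
  congr 2
  funext j
  ring

theorem isGelfandYaglomRatio_airyRatio {b : ℝ} (hb : b ≠ 0) :
    IsGelfandYaglomRatio (fun x => b ^ 3 * x) (airyRatio b) := by
  refine ⟨fun x => airySeriesG (b * x) / b, fun x => x,
    ⟨_, fun x _ => (hasDerivAt_airySeriesG_scaled hb x).hasDerivWithinAt,
      fun x _ => (hasDerivAt_airySeriesGDeriv_scaled hb x).hasDerivWithinAt,
      by simp [airySeriesG_zero], by simp [airySeriesGDeriv_zero]⟩,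
    ⟨fun _ => 1, fun x _ => hasDerivWithinAt_id x _, fun x _ => ?_, rfl, rfl⟩, ?_⟩
  · simpa using hasDerivWithinAt_const x _ (1 : ℝ)
  · simp [airyRatio_eq]

theorem realCbrt_pow_three (x : ℝ) : realCbrt (x ^ 3) = x := by
  have hroot : |x ^ 3| ^ (1 / 3 : ℝ) = |x| := by
    rw [abs_pow, ← Real.rpow_natCast, ← Real.rpow_mul (abs_nonneg x)]
    norm_num
  rw [realCbrt, hroot]
  rcases lt_trichotomy x 0 with hx | rfl | hx
  · rw [Real.sign_of_neg (Odd.pow_neg (by decide) hx), abs_of_neg hx]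
    ring
  · simp
  · rw [Real.sign_of_pos (by positivity), abs_of_pos hx, one_mul]

theorem mainTheorem2 (b : ℝ) (hb : b ≠ 0) :
    Tendsto (fun p : ℕ => pathStep p * lommelR (lommelArg b p) p (lommelArg b p)) atTop
      (𝓝 (airyRatio b)) ∧
    ((0 < b ∨ airyRatio b ≠ 0) →
      (fun p : ℕ => lommelR (lommelArg b p) p (lommelArg b p)) ~[atTop]
          (fun p : ℕ => Real.pi * realCbrt (lommelArg b p / 2) *
            (airyAi 0 * airyBi b - airyBi 0 * airyAi b)) ∧
      (fun p : ℕ => lommelR (lommelArg b p) p (lommelArg b p)) ~[atTop]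
          (fun p : ℕ => 1 / pathStep p * airyRatio b)) ∧
    Tendsto (fun p : ℕ => discreteDetRatio p ((b * pathStep p) ^ 3)) atTop
      (𝓝 (airyRatio b)) ∧
    IsGelfandYaglomRatio (fun x => b ^ 3 * x) (airyRatio b) := by
  have hstep : ∀ p, pathStep p ≠ 0 := fun p => (pathStep_pos p).ne'
  have hlim := tendsto_schrodingerSeq_linear hb
  have hlommel : Tendsto (fun p : ℕ => pathStep p * lommelR (lommelArg b p) p (lommelArg b p))
      atTop (𝓝 (airyRatio b)) := by
    refine hlim.congr fun p => ?_
    have hz : lommelArg b p ≠ 0 :=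
      div_ne_zero two_ne_zero (pow_ne_zero 3 (mul_ne_zero hb (hstep p)))
    rw [lommelR_self_eq hz, lommelArg, div_div_cancel₀ two_ne_zero]
  refine ⟨hlommel, fun h => ?_, hlim.congr fun p => (discreteDetRatio_eq p _).symm,
    isGelfandYaglomRatio_airyRatio hb⟩
  have hD : airyRatio b ≠ 0 := by
    rcases h with h | h
    · rw [airyRatio_eq]
      exact (div_pos (airySeriesG_pos h) h).ne'
    · exact h
  have hequiv : (fun p : ℕ => lommelR (lommelArg b p) p (lommelArg b p)) ~[atTop]
      (fun p : ℕ => 1 / pathStep p * airyRatio b) := by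
    refine isEquivalent_of_tendsto_one ?_
    have := hlommel.div_const (airyRatio b)
    rw [div_self hD] at this
    refine this.congr fun p => ?_
    have := hstep p
    rw [Pi.div_apply]
    field_simp
  refine ⟨?_, hequiv⟩
  convert hequiv using 2 with p
  have := hstep p
  -- The real cube root of `z / 2` is `1 / (b h)` for either sign of `b`, so the two comparison
  -- sequences coincide.
  have hz : lommelArg b p / 2 = (1 / (b * pathStep p)) ^ 3 := by
    rw [lommelArg]
    field_simp
  rw [hz, realCbrt_pow_three, airyRatio]
  field_simp
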